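/- Let $V:\mathbb{R}^d\to\mathbb{R}$ be twice differentiable with $\alpha I\preceq\nabla^2V(x)\preceq\beta I$ for all $x\in\mathbb{R}^d$, where $\alpha,\beta\in\mathbb{R}$. Let $h>0$, let $N\ge 1$ be an integer, and put $L=\max(|1-h\alpha|,|1-h\beta|)$. Let $\hat P_h$ be the Markov kernel of the discretized Langevin diffusion with step size $h$, that is, $\hat P_h(x,\cdot)=\mathcal N(x-h\nabla V(x),\,2hI)$. Put $$C=\frac{1-L^2}{4h\,(L^{-2N}-1)},$$ where for $L=1$ and $L=0$ the expression is read as its limits $\frac1{4hN}$ and $0$, respectively. Then for all Borel probability measures $\mu,\nu$ on $\mathbb{R}^d$, $$\mathsf{KL}(\mu\hat P_h^N\,\|\,\nu\hat P_h^N)\le C\,W_2^2(\mu,\nu)$$ (with the convention $0\cdot\infty=0$ on the right-hand side), and for every $q\in(0,1)\cup(1,\infty)$, $$\mathsf{R}_q(\mu\hat P_h^N\,\|\,\nu\hat P_h^N)\le\inf_{\gamma\in\mathscr C(\mu,\nu)}\frac1{q-1}\log\int\exp\bigl(q(q-1)\,C\,\|x-y\|^2\bigr)\,\gamma(\mathrm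 dx,\mathrm dy).$$ Here $\mathscr C(\mu,\nu)$ is the set of couplings of $\mu$ and $\nu$, $W_2^2(\mu,\nu)=\inf_{\gamma\in\mathscr C(\mu,\nu)}\int\|x-y\|^2\,\gamma(\mathrm dx,\mathrm dy)\in[0,\infty]$, and $\mathsf R_q$ is the Rényi divergence of order $q$: $\mathsf R_q(\mu\|\nu)=\frac1{q-1}\log\int(\frac{\mathrm d\mu}{\mathrm d\nu})^q\,\mathrm d\nu$ if $\mu\ll\nu$; otherwise $\mathsf R_q(\mu\|\nu)=+\infty$ for $q>1$ and $\mathsf R_q(\mu\|\nu)=\frac1{q-1}\log\int(\frac{\mathrm d\mu}{\mathrm d\lambda})^q(\frac{\mathrm d\nu}{\mathrm d\lambda})^{1-q}\,\mathrm d\lambda$ with $\lambda=\mu+\nu$ for $q<1$, all with values in $[0,\infty]$ (and $\log 0=-\infty$, $\log\infty=\infty$). -/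

import Mathlib

open MeasureTheory ProbabilityTheory InformationTheory
open scoped ENNReal

noncomputable section

namespace LangevinRegularity

open scoped MatrixOrder in
/-- The heat semigroup on `ℝ^d` as a family of Markov kernels: `Q_t(x, ·) = N(x, t I)`. -/
def heatKernel (d : ℕ) (t : ℝ) :
    Kernel (EuclideanSpace ℝ (Fin d)) (EuclideanSpace ℝ (Fin d)) where
  toFun x := multivariateGaussian x (t • (1 : Matrix (Fin d) (Fin d) ℝ))
  measurable' := by
    refine Measure.measurable_of_measurable_coe _ fun s hs => ?_
    have h : ∀ x : EuclideanSpace ℝ (Fin d),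
        multivariateGaussian x (t • (1 : Matrix (Fin d) (Fin d) ℝ)) s =
          ∫⁻ z, s.indicator 1 (x + Matrix.toEuclideanCLM (𝕜 := ℝ)
            (CFC.sqrt (t • (1 : Matrix (Fin d) (Fin d) ℝ))) z)
            ∂(stdGaussian (EuclideanSpace ℝ (Fin d))) := by
      intro x
      rw [multivariateGaussian, ← lintegral_indicator_one hs,
        lintegral_map (measurable_one.indicator hs) (by fun_prop)]
    simp_rw [h]
    refine Measurable.lintegral_prod_right' (f := fun p : EuclideanSpace ℝ (Fin d) ×
      EuclideanSpace ℝ (Fin d) => s.indicator 1 (p.1 + Matrix.toEuclideanCLM (𝕜 := ℝ)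
            (CFC.sqrt (t • (1 : Matrix (Fin d) (Fin d) ℝ))) p.2)) ?_
    exact (measurable_one.indicator hs).comp (by fun_prop)

theorem measurable_gradient {d : ℕ} (V : EuclideanSpace ℝ (Fin d) → ℝ) :
    Measurable (gradient V) :=
  (InnerProductSpace.toDual ℝ (EuclideanSpace ℝ (Fin d))).symm.continuous.measurable.comp
    (measurable_fderiv ℝ V)

/-- The kernel of the discretized Langevin diffusion with potential `V` and step size `h`:
`P̂_h(x, ·) = Q_{2h}(x - h ∇V(x), ·)`. -/
def langevinKernel {d : ℕ} (V : EuclideanSpace ℝ (Fin d) → ℝ) (h : ℝ) :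
    Kernel (EuclideanSpace ℝ (Fin d)) (EuclideanSpace ℝ (Fin d)) :=
  (heatKernel d (2 * h)).comap (fun x => x - h • gradient V x)
    (measurable_id.sub ((measurable_gradient V).const_smul h))

/-- The law `μ P̂_h^N` after `N` steps of the discretized Langevin chain started from `μ`. -/
def langevinLaw {d : ℕ} (V : EuclideanSpace ℝ (Fin d) → ℝ) (h : ℝ) (N : ℕ)
    (μ : Measure (EuclideanSpace ℝ (Fin d))) : Measure (EuclideanSpace ℝ (Fin d)) :=
  Measure.bind μ ⇑(langevinKernel V h ^ N)

/-- The Hessian `∇²V(x)`, as the derivative of the gradient field. -/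
def hessian {d : ℕ} (V : EuclideanSpace ℝ (Fin d) → ℝ) (x : EuclideanSpace ℝ (Fin d)) :
    EuclideanSpace ℝ (Fin d) →L[ℝ] EuclideanSpace ℝ (Fin d) :=
  fderiv ℝ (gradient V) x

/-- The couplings of `μ` and `ν`: measures on the product with marginals `μ` and `ν`. -/
def couplings {Ω₁ Ω₂ : Type*} [MeasurableSpace Ω₁] [MeasurableSpace Ω₂]
    (μ : Measure Ω₁) (ν : Measure Ω₂) : Set (Measure (Ω₁ × Ω₂)) :=
  {γ | γ.map Prod.fst = μ ∧ γ.map Prod.snd = ν}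

/-- The `2`-Wasserstein distance, with values in `[0, ∞]`. -/
def wasserstein2 {d : ℕ} (μ ν : Measure (EuclideanSpace ℝ (Fin d))) : ℝ≥0∞ :=
  (⨅ γ ∈ couplings μ ν, ∫⁻ p, ENNReal.ofReal (‖p.1 - p.2‖ ^ 2) ∂γ) ^ (1 / 2 : ℝ)

open Classical in
/-- The Rényi divergence of order `q ∈ (0, ∞)`, with values in the extended reals. Here
`ENNReal.log 0 = ⊥` and `ENNReal.log ∞ = ⊤`. -/
def renyiDiv {Ω : Type*} [MeasurableSpace Ω] (q : ℝ) (μ ν : Measure Ω) : EReal :=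
  if q = 1 then (klDiv μ ν : EReal)
  else if μ ≪ ν then
    (((q - 1)⁻¹ : ℝ) : EReal) * ENNReal.log (∫⁻ x, (μ.rnDeriv ν x) ^ q ∂ν)
  else if 1 < q then ⊤
  else
    (((q - 1)⁻¹ : ℝ) : EReal) *
      ENNReal.log (∫⁻ x, (μ.rnDeriv (μ + ν) x) ^ q * (ν.rnDeriv (μ + ν) x) ^ (1 - q) ∂(μ + ν))

/-- The constant `(1 - L²) / (4h (L^{-2N} - 1))`, for `L ≥ 0` and `N ≥ 1`, with its limiting values
`0` at `L = 0` and `1 / (4hN)` at `L = 1`. -/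
def regularityConst (L h : ℝ) (N : ℕ) : ℝ :=
  if L = 0 then 0
  else if L = 1 then 1 / (4 * h * N)
  else (1 - L ^ 2) / (4 * h * (L ^ (-(2 * (N : ℤ))) - 1))

end LangevinRegularity

end

/-! Write `b = 1/(4h)` and let `φ x = x - h∇V(x)`, which is `L`-Lipschitz because the spectrum of `I
- h∇²V` lies in `[1 - hβ, 1 - hα]`. All divergences are read off the Hellinger integrals `∫ f^q
g^(1-q)`. For two Gaussians of the same covariance these equal `exp(q(q-1) b ‖v‖²)`, with `v` the
difference of the means.

The proof is a shifted composition argument, by induction on the number of steps. A density after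
one more step is a Gaussian mixture of the previous densities. The mixing variable of one of the two
mixtures is translated so that a fraction `η` of the displacement `φ x - φ y` is paid at once by the
Gaussian weights, at rate `b`, and the rest later by the remaining steps, at rate `C_N`. Joint
convexity of `f^q g^(1-q)` for `q > 1` (concavity for `q < 1`) bounds the Hellinger integral of the
mixtures, giving the rate `(1-η)² C_N + η² b`. The best `η` gives `C_N b/(C_N + b)`, and the
Lipschitz bound multiplies it by `L²`: this is the recursion of `regularityConst`.

The same convexity, applied to a coupling, passes from point masses to `μ` and `ν`. The KL bound
follows from the bounds for `q < 1` by letting `q ↑ 1`. The main lemmas are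
`lintegral_rpow_gaussian_mixture_le`, `le_lintegral_rpow_gaussian_mixture`, `regularityConst_succ`
and `klDiv_withDensity_le`. -/

noncomputable section

namespace LangevinRegularity

/-! ### Lipschitz bound for the gradient step; Gaussian densities. -/

section GaussianDensity

/-- The Hessian of a twice differentiable function is symmetric. -/
theorem hessian_isSymmetric {d : ℕ} {V : EuclideanSpace ℝ (Fin d) → ℝ}
    (hV : Differentiable ℝ V) (hV' : Differentiable ℝ (gradient V))
    (x : EuclideanSpace ℝ (Fin d)) :
    (hessian V x : EuclideanSpace ℝ (Fin d) →ₗ[ℝ] EuclideanSpace ℝ (Fin d)).IsSymmetric := by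
  have h1 : ∀ y, HasFDerivAt V (innerSL ℝ (gradient V y)) y := fun y =>
    (hV y).hasGradientAt.hasFDerivAt
  have h2 : HasFDerivAt (fun y => innerSL ℝ (gradient V y)) ((innerSL ℝ).comp (hessian V x)) x :=
    (innerSL ℝ).hasFDerivAt.comp x (hV' x).hasFDerivAt
  intro v w
  have := second_derivative_symmetric h1 h2 v w
  simp only [ContinuousLinearMap.comp_apply, innerSL_apply_apply] at this
  rwa [real_inner_comm v] at this

/-- A symmetric operator is bounded by a bound of its quadratic form. -/
theorem norm_le_of_abs_inner_le {E : Type*} [NormedAddCommGroup E] [InnerProductSpace ℝ E]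
    {T : E →L[ℝ] E} (hT : (T : E →ₗ[ℝ] E).IsSymmetric) {L : ℝ} (hL : 0 ≤ L)
    (h : ∀ v, |inner ℝ (T v) v| ≤ L * ‖v‖ ^ 2) : ‖T‖ ≤ L := by
  rw [ContinuousLinearMap.norm_eq_iSup_rayleighQuotient T hT]
  refine Real.iSup_le (fun v => ?_) hL
  rw [ContinuousLinearMap.rayleighQuotient, abs_div, abs_of_nonneg (sq_nonneg ‖v‖)]
  exact div_le_of_le_mul₀ (sq_nonneg _) hL (h v)

/-- The gradient step is Lipschitz. -/
theorem norm_gradientStep_sub_le {d : ℕ} {V : EuclideanSpace ℝ (Fin d) → ℝ} {α β h : ℝ}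
    (hV : Differentiable ℝ V) (hV' : Differentiable ℝ (gradient V))
    (hα : ∀ x v, α * ‖v‖ ^ 2 ≤ inner ℝ (hessian V x v) v)
    (hβ : ∀ x v, inner ℝ (hessian V x v) v ≤ β * ‖v‖ ^ 2) (hh : 0 < h)
    (x y : EuclideanSpace ℝ (Fin d)) :
    ‖(x - h • gradient V x) - (y - h • gradient V y)‖
      ≤ max |1 - h * α| |1 - h * β| * ‖x - y‖ := by
  set L := max |1 - h * α| |1 - h * β| with hL
  have hd : ∀ z, HasFDerivAt (fun x => x - h • gradient V x)
      (ContinuousLinearMap.id ℝ _ - h • hessian V z) z := fun z =>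
    (hasFDerivAt_id z).sub ((hV' z).hasFDerivAt.const_smul h)
  refine Convex.norm_image_sub_le_of_norm_hasFDerivWithin_le (s := Set.univ)
    (fun z _ => (hd z).hasFDerivWithinAt) (fun z _ => ?_) convex_univ trivial trivial
  -- The derivative `I - h∇²V` is symmetric, so bounds on its quadratic form control its operator
  -- norm.
  refine norm_le_of_abs_inner_le ?_ (le_max_of_le_left (abs_nonneg _)) fun v => ?_
  · intro v w
    have := hessian_isSymmetric hV hV' z v w
    simp only [ContinuousLinearMap.coe_coe] at this
    simp [inner_sub_left, inner_sub_right, inner_smul_left, inner_smul_right, this]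
  · have h1 := hα z v
    have h2 := hβ z v
    have e : inner ℝ ((ContinuousLinearMap.id ℝ (EuclideanSpace ℝ (Fin d)) - h • hessian V z) v) v
        = ‖v‖ ^ 2 - h * inner ℝ (hessian V z v) v := by
      simp [inner_sub_left, inner_smul_left]
    have l1 : 1 - h * α ≤ L := (le_abs_self _).trans (le_max_left _ _)
    have l2 : -(1 - h * β) ≤ L := (neg_le_abs _).trans (le_max_right _ _)
    have hv := sq_nonneg ‖v‖
    rw [e, abs_le]
    constructor <;> nlinarith [mul_le_mul_of_nonneg_left h1 hh.le,
      mul_le_mul_of_nonneg_left h2 hh.le,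
      mul_le_mul_of_nonneg_right l1 hv, mul_le_mul_of_nonneg_right l2 hv]

/-- The Gaussian density `(b / π) ^ (d / 2) * exp (-b ‖z‖²)`, centered at the origin. -/
def gaussianDensity (d : ℕ) (b : ℝ) (z : EuclideanSpace ℝ (Fin d)) : ℝ≥0∞ :=
  ENNReal.ofReal (((Real.pi / b) ^ (d / 2 : ℝ))⁻¹ * Real.exp (-b * ‖z‖ ^ 2))

variable {d : ℕ} {b : ℝ}

@[fun_prop]
theorem measurable_gaussianDensity : Measurable (gaussianDensity d b) := by
  unfold gaussianDensity
  fun_prop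

theorem gaussianDensity_ne_zero (hb : 0 < b) (z : EuclideanSpace ℝ (Fin d)) :
    gaussianDensity d b z ≠ 0 := by
  have : 0 < Real.pi / b := div_pos Real.pi_pos hb
  simp only [gaussianDensity, ne_eq, ENNReal.ofReal_eq_zero, not_le]
  positivity

theorem gaussianDensity_ne_top (z : EuclideanSpace ℝ (Fin d)) :
    gaussianDensity d b z ≠ ∞ := ENNReal.ofReal_ne_top

theorem gaussianDensity_le (hb : 0 < b) (z : EuclideanSpace ℝ (Fin d)) :
    gaussianDensity d b z ≤ gaussianDensity d b 0 := by
  have : 0 < Real.pi / b := div_pos Real.pi_pos hb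
  refine ENNReal.ofReal_le_ofReal (mul_le_mul_of_nonneg_left ?_ (by positivity))
  refine Real.exp_le_exp.2 ?_
  have : 0 ≤ b * ‖z‖ ^ 2 := by positivity
  simpa using this

theorem integrable_exp_neg_mul_sq_norm (hb : 0 < b) :
    Integrable (fun z : EuclideanSpace ℝ (Fin d) => Real.exp (-b * ‖z‖ ^ 2)) := by
  refine Integrable.of_integral_ne_zero ?_
  rw [GaussianFourier.integral_rexp_neg_mul_sq_norm hb]
  have : 0 < Real.pi / b := div_pos Real.pi_pos hb
  positivity

theorem lintegral_gaussianDensity (hb : 0 < b) :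
    ∫⁻ z, gaussianDensity d b z = 1 := by
  have : 0 < Real.pi / b := div_pos Real.pi_pos hb
  unfold gaussianDensity
  rw [← ofReal_integral_eq_lintegral_ofReal ((integrable_exp_neg_mul_sq_norm hb).const_mul _)
    (ae_of_all _ fun z => by positivity), integral_const_mul,
    GaussianFourier.integral_rexp_neg_mul_sq_norm hb]
  rw [finrank_euclideanSpace_fin, inv_mul_cancel₀ (by positivity), ENNReal.ofReal_one]

theorem lintegral_gaussianDensity_sub (hb : 0 < b) (x : EuclideanSpace ℝ (Fin d)) :
    ∫⁻ z, gaussianDensity d b (z - x) = 1 := by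
  rw [lintegral_sub_right_eq_self (gaussianDensity d b) x, lintegral_gaussianDensity hb]

/-- Completing the square: `q‖z‖² + (1-q)‖z+v‖² = ‖z+(1-q)v‖² + q(1-q)‖v‖²`. Being an identity in
`q`, it serves both `q < 1` and `q > 1`. -/
theorem gaussianDensity_rpow_mul_rpow (hb : 0 < b) (q : ℝ) (z v : EuclideanSpace ℝ (Fin d)) :
    gaussianDensity d b z ^ q * gaussianDensity d b (z + v) ^ (1 - q) =
      gaussianDensity d b (z + (1 - q) • v) *
        ENNReal.ofReal (Real.exp (q * (q - 1) * b * ‖v‖ ^ 2)) := by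
  have : 0 < Real.pi / b := div_pos Real.pi_pos hb
  have hc : 0 < ((Real.pi / b) ^ (d / 2 : ℝ))⁻¹ := by positivity
  unfold gaussianDensity
  set c := ((Real.pi / b) ^ (d / 2 : ℝ))⁻¹
  rw [ENNReal.ofReal_rpow_of_pos (by positivity), ENNReal.ofReal_rpow_of_pos (by positivity),
    ← ENNReal.ofReal_mul (by positivity), ← ENNReal.ofReal_mul (by positivity)]
  congr 1
  rw [Real.mul_rpow hc.le (by positivity), Real.mul_rpow hc.le (by positivity), ← Real.exp_mul,
    ← Real.exp_mul]
  have e1 : c ^ q * c ^ (1 - q) = c := by rw [← Real.rpow_add hc]; simp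
  calc _ = (c ^ q * c ^ (1 - q)) *
        (Real.exp (-b * ‖z‖ ^ 2 * q) * Real.exp (-b * ‖z + v‖ ^ 2 * (1 - q))) := by ring
    _ = _ := by
      rw [e1, mul_assoc c, ← Real.exp_add, ← Real.exp_add]
      congr 2
      rw [norm_add_sq_real, norm_add_sq_real, inner_smul_right, norm_smul,
        mul_pow, Real.norm_eq_abs, sq_abs]
      ring

open scoped MatrixOrder in
theorem heatKernel_eq_withDensity {t : ℝ} (ht : 0 < t) (x : EuclideanSpace ℝ (Fin d)) :
    heatKernel d t x = volume.withDensity (fun z => gaussianDensity d (1 / (2 * t)) (z - x)) := by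
  set b := 1 / (2 * t) with hb'
  have hb : 0 < b := by positivity
  have hp : 0 < Real.pi / b := div_pos Real.pi_pos hb
  change multivariateGaussian x (t • (1 : Matrix (Fin d) (Fin d) ℝ)) = _
  have : IsProbabilityMeasure ((volume : Measure (EuclideanSpace ℝ (Fin d))).withDensity
      (fun z => gaussianDensity d b (z - x))) :=
    ⟨by rw [withDensity_apply _ MeasurableSet.univ, setLIntegral_univ,
      lintegral_gaussianDensity_sub hb]⟩
  refine Measure.ext_of_charFun ?_
  ext w
  rw [charFun_multivariateGaussian (Matrix.PosSemidef.one.smul ht.le), charFun_apply,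
    integral_withDensity_eq_integral_toReal_smul (by fun_prop)
      (ae_of_all _ fun z => gaussianDensity_ne_top _ |>.lt_top)]
  -- The integrand of the characteristic function recentred at `x`, with the phase `exp(i⟨w,x⟩)`
  -- pulled out.
  let F : EuclideanSpace ℝ (Fin d) → ℂ := fun z => ((((Real.pi / b) ^ (d / 2 : ℝ))⁻¹ : ℝ) : ℂ) *
    Complex.exp ((inner ℝ w x : ℝ) * Complex.I) *
    Complex.exp (-(b : ℂ) * ‖z‖ ^ 2 + Complex.I * (inner ℝ w z : ℝ))
  have e : ∀ z : EuclideanSpace ℝ (Fin d),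
      (gaussianDensity d b (z - x)).toReal • Complex.exp ((inner ℝ z w : ℝ) * Complex.I)
      = F (z - x) := by
    intro z
    rw [gaussianDensity, ENNReal.toReal_ofReal (by positivity)]
    simp only [F, Complex.real_smul, Complex.ofReal_mul, Complex.ofReal_exp]
    rw [mul_assoc, mul_assoc, ← Complex.exp_add, ← Complex.exp_add]
    congr 2
    rw [real_inner_comm w z, inner_sub_right]
    push_cast
    ring
  rw [integral_congr_ae (ae_of_all _ e), integral_sub_right_eq_self F x, integral_const_mul,
    GaussianFourier.integral_cexp_neg_mul_sq_norm_add (by simpa using hb)]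
  rw [finrank_euclideanSpace_fin]
  have e3 : ((Real.pi : ℂ) / b) ^ ((d : ℂ) / 2) = (((Real.pi / b) ^ (d / 2 : ℝ) : ℝ) : ℂ) := by
    rw [Complex.ofReal_cpow hp.le]; push_cast; rfl
  have e4 : (((Real.pi / b) ^ (d / 2 : ℝ) : ℝ) : ℂ) ≠ 0 := by
    exact_mod_cast (Real.rpow_pos_of_pos hp _).ne'
  rw [e3, Complex.ofReal_inv]
  rw [show ∀ a e f : ℂ, a ≠ 0 → a⁻¹ * e * (a * f) = e * f by intro a e f ha; field_simp]
  · rw [← Complex.exp_add, sub_eq_add_neg]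
    congr 2
    have : w.ofLp ⬝ᵥ (t • (1 : Matrix (Fin d) (Fin d) ℝ)).mulVec w.ofLp = t * ‖w‖ ^ 2 := by
      rw [EuclideanSpace.real_norm_sq_eq, Matrix.smul_mulVec, Matrix.one_mulVec,
        dotProduct_smul, smul_eq_mul]
      simp [dotProduct, sq]
    rw [this, Complex.I_sq, hb']
    push_cast
    have : (t : ℂ) ≠ 0 := by exact_mod_cast ht.ne'
    field_simp
    ring
  · exact e4

end GaussianDensity

/-! ### The shifted composition step and the recursion for the constant. -/

section ShiftedComposition

variable {d : ℕ} {b : ℝ}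

/-- Joint convexity of `(f, g) ↦ f ^ q * g ^ (1 - q)` for `q > 1`. -/
theorem rpow_lintegral_mul_rpow_lintegral_le {Ω : Type*} [MeasurableSpace Ω] {m : Measure Ω}
    {f g : Ω → ℝ≥0∞} (hf : Measurable f) (hg : Measurable g) (hg0 : ∀ x, g x ≠ 0)
    (hgt : ∀ x, g x ≠ ∞) (h0 : ∫⁻ x, g x ∂m ≠ 0) (ht : ∫⁻ x, g x ∂m ≠ ∞) {q : ℝ} (hq : 1 < q) :
    (∫⁻ x, f x ∂m) ^ q * (∫⁻ x, g x ∂m) ^ (1 - q) ≤ ∫⁻ x, f x ^ q * g x ^ (1 - q) ∂m := by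
  have hq0 : 0 < q := by linarith
  have hq' : q⁻¹ ≤ 1 := inv_le_one_of_one_le₀ hq.le
  -- Hölder for the factorization `f = (f^q g^(1-q))^(1/q) · g^(1-1/q)`.
  have key := ENNReal.lintegral_mul_norm_pow_le (μ := m)
    (f := fun x => f x ^ q * g x ^ (1 - q)) (g := g)
    (by fun_prop) hg.aemeasurable (p := q⁻¹) (q := 1 - q⁻¹) (by positivity) (by linarith) (by ring)
  have e : ∀ x, (f x ^ q * g x ^ (1 - q)) ^ q⁻¹ * g x ^ (1 - q⁻¹) = f x := by
    intro x
    rw [ENNReal.mul_rpow_of_nonneg _ _ (by positivity), ← ENNReal.rpow_mul, ← ENNReal.rpow_mul,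
      mul_inv_cancel₀ hq0.ne', ENNReal.rpow_one, mul_assoc, ← ENNReal.rpow_add _ _ (hg0 x) (hgt x)]
    rw [show (1 - q) * q⁻¹ + (1 - q⁻¹) = 0 by field_simp; ring]
    simp
  simp_rw [e] at key
  calc (∫⁻ x, f x ∂m) ^ q * (∫⁻ x, g x ∂m) ^ (1 - q)
      ≤ ((∫⁻ x, f x ^ q * g x ^ (1 - q) ∂m) ^ q⁻¹ * (∫⁻ x, g x ∂m) ^ (1 - q⁻¹)) ^ q
          * (∫⁻ x, g x ∂m) ^ (1 - q) := by gcongr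
    _ = ∫⁻ x, f x ^ q * g x ^ (1 - q) ∂m := by
      rw [ENNReal.mul_rpow_of_nonneg _ _ hq0.le, ← ENNReal.rpow_mul, ← ENNReal.rpow_mul,
        inv_mul_cancel₀ hq0.ne', ENNReal.rpow_one, mul_assoc, ← ENNReal.rpow_add _ _ h0 ht,
        show (1 - q⁻¹) * q + (1 - q) = 0 by field_simp; ring]
      simp

variable {p : EuclideanSpace ℝ (Fin d) → EuclideanSpace ℝ (Fin d) → ℝ≥0∞}

/-- Translation invariance of Lebesgue measure; `v` is free, and choosing it differently in the two
mixtures produces the shift. -/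
theorem lintegral_gaussianDensity_mul_eq (u v : EuclideanSpace ℝ (Fin d))
    (f : EuclideanSpace ℝ (Fin d) → ℝ≥0∞) :
    ∫⁻ w, gaussianDensity d b (w - u) * f w =
      ∫⁻ w, gaussianDensity d b (w + v) * f (w + (u + v)) := by
  rw [← lintegral_add_right_eq_self (fun w => gaussianDensity d b (w - u) * f w) (u + v)]
  simp only [← add_assoc]
  congr with w
  congr 2
  abel

theorem lintegral_lintegral_gaussianDensity_rpow (hb : 0 < b)
    (hp : Measurable (Function.uncurry p)) (hpt : ∀ x z, p x z ≠ ∞)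
    (q : ℝ) (u u' v : EuclideanSpace ℝ (Fin d)) :
    ∫⁻ z, ∫⁻ w, (gaussianDensity d b w * p (w + u) z) ^ q *
        (gaussianDensity d b (w + v) * p (w + u') z) ^ (1 - q) =
      ENNReal.ofReal (Real.exp (q * (q - 1) * b * ‖v‖ ^ 2)) *
        ∫⁻ w, gaussianDensity d b (w + (1 - q) • v) *
          ∫⁻ z, p (w + u) z ^ q * p (w + u') z ^ (1 - q) := by
  have hm : ∀ a : EuclideanSpace ℝ (Fin d), Measurable
      (fun r : EuclideanSpace ℝ (Fin d) × EuclideanSpace ℝ (Fin d) => p (r.1 + a) r.2) :=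
    fun a => hp.comp (f := fun r : EuclideanSpace ℝ (Fin d) × EuclideanSpace ℝ (Fin d) =>
      (r.1 + a, r.2)) (by fun_prop)
  have hH : Measurable fun r : EuclideanSpace ℝ (Fin d) × EuclideanSpace ℝ (Fin d) =>
      p (r.1 + u) r.2 ^ q * p (r.1 + u') r.2 ^ (1 - q) :=
    ((hm u).pow_const q).mul ((hm u').pow_const _)
  have e : ∀ w z, (gaussianDensity d b w * p (w + u) z) ^ q *
        (gaussianDensity d b (w + v) * p (w + u') z) ^ (1 - q) =
      ENNReal.ofReal (Real.exp (q * (q - 1) * b * ‖v‖ ^ 2)) *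
        (gaussianDensity d b (w + (1 - q) • v) * (p (w + u) z ^ q * p (w + u') z ^ (1 - q))) := by
    intro w z
    rw [ENNReal.mul_rpow_of_ne_top (gaussianDensity_ne_top _) (hpt _ _),
      ENNReal.mul_rpow_of_ne_top (gaussianDensity_ne_top _) (hpt _ _), mul_mul_mul_comm,
      gaussianDensity_rpow_mul_rpow hb]
    ring
  simp_rw [e]
  rw [lintegral_lintegral_swap, ← lintegral_const_mul]
  · refine lintegral_congr fun w => ?_
    have hH' : Measurable fun z => p (w + u) z ^ q * p (w + u') z ^ (1 - q) :=
      hH.comp (measurable_prodMk_left (x := w))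
    rw [lintegral_const_mul _ (by fun_prop), lintegral_const_mul _ hH']
  · exact Measurable.mul (by fun_prop) hH.lintegral_prod_right'
  · have := hH.comp measurable_swap
    refine Measurable.aemeasurable ?_
    refine Measurable.const_mul (Measurable.mul (by fun_prop) this) _

theorem lintegral_gaussianDensity_add_mul_const (hb : 0 < b) (v : EuclideanSpace ℝ (Fin d))
    (c : ℝ≥0∞) :
    ∫⁻ w, gaussianDensity d b (w + v) * c = c := by
  rw [lintegral_mul_const _ (by fun_prop), lintegral_add_right_eq_self (gaussianDensity d b) v,
    lintegral_gaussianDensity hb, one_mul]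

theorem exp_mul_exp_shift {q c η : ℝ} (u u' w : EuclideanSpace ℝ (Fin d)) :
    ENNReal.ofReal (Real.exp (q * (q - 1) * b * ‖η • (u - u')‖ ^ 2)) *
      ENNReal.ofReal (Real.exp (q * (q - 1) * c * ‖(w + u) - (w + (u' + η • (u - u')))‖ ^ 2)) =
    ENNReal.ofReal (Real.exp (q * (q - 1) * ((1 - η) ^ 2 * c + η ^ 2 * b) * ‖u - u'‖ ^ 2)) := by
  have e : (w + u) - (w + (u' + η • (u - u'))) = (1 - η) • (u - u') := by module
  rw [← ENNReal.ofReal_mul (by positivity), ← Real.exp_add, e, norm_smul, norm_smul, mul_pow,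
    mul_pow, Real.norm_eq_abs, Real.norm_eq_abs, sq_abs, sq_abs]
  congr 2
  ring

/-- One step of the shifted composition argument, for `q > 1`. -/
theorem lintegral_rpow_gaussian_mixture_le (hb : 0 < b) (hp : Measurable (Function.uncurry p))
    (hp0 : ∀ x z, p x z ≠ 0) (hpt : ∀ x z, p x z ≠ ∞) {q c : ℝ} (hq : 1 < q)
    (hpc : ∀ x y, ∫⁻ z, p x z ^ q * p y z ^ (1 - q)
      ≤ ENNReal.ofReal (Real.exp (q * (q - 1) * c * ‖x - y‖ ^ 2)))
    (u u' : EuclideanSpace ℝ (Fin d)) (η : ℝ)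
    (h0 : ∀ z, ∫⁻ w, gaussianDensity d b (w - u') * p w z ≠ 0)
    (ht : ∀ z, ∫⁻ w, gaussianDensity d b (w - u') * p w z ≠ ∞) :
    ∫⁻ z, (∫⁻ w, gaussianDensity d b (w - u) * p w z) ^ q *
        (∫⁻ w, gaussianDensity d b (w - u') * p w z) ^ (1 - q) ≤
      ENNReal.ofReal (Real.exp (q * (q - 1) * ((1 - η) ^ 2 * c + η ^ 2 * b) * ‖u - u'‖ ^ 2)) := by
  -- After re-indexing, the Gaussian weights differ by the shift `v`, and the base points of `p` by
  -- only `(1-η)(u-u')`.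
  set v := η • (u - u')
  have hpz : ∀ z, Measurable fun w => p w z := fun z => hp.of_uncurry_right
  calc _ ≤ ∫⁻ z, ∫⁻ w, (gaussianDensity d b w * p (w + u) z) ^ q *
        (gaussianDensity d b (w + v) * p (w + (u' + v)) z) ^ (1 - q) := by
        refine lintegral_mono fun z => ?_
        have hz0 := h0 z
        have hzt := ht z
        rw [lintegral_gaussianDensity_mul_eq u' v] at hz0 hzt
        dsimp only
        rw [lintegral_gaussianDensity_mul_eq u 0, lintegral_gaussianDensity_mul_eq u' v]
        simp only [add_zero]
        exact rpow_lintegral_mul_rpow_lintegral_le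
          (Measurable.mul (by fun_prop) ((hpz z).comp (measurable_add_const _)))
          (Measurable.mul (by fun_prop) ((hpz z).comp (measurable_add_const _)))
          (fun w => mul_ne_zero (gaussianDensity_ne_zero hb _) (hp0 _ _))
          (fun w => ENNReal.mul_ne_top (gaussianDensity_ne_top _) (hpt _ _)) hz0 hzt hq
    _ ≤ _ := by
        rw [lintegral_lintegral_gaussianDensity_rpow hb hp hpt]
        -- The two base points differ by a vector independent of `w`, so the bound is constant and
        -- the Gaussian integrates out.
        grw [lintegral_mono fun w => mul_le_mul_right (hpc (w + u) (w + (u' + v))) _]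
        simp only [add_sub_add_left_eq_sub]
        rw [lintegral_gaussianDensity_add_mul_const hb]
        have := exp_mul_exp_shift (b := b) (q := q) (c := c) (η := η) u u' 0
        simp only [add_sub_add_left_eq_sub] at this
        exact this.le

/-- One step of the shifted composition argument, for `q < 1`. -/
theorem le_lintegral_rpow_gaussian_mixture (hb : 0 < b) (hp : Measurable (Function.uncurry p))
    (hpt : ∀ x z, p x z ≠ ∞) {q c : ℝ} (hq0 : 0 < q) (hq : q < 1)
    (hpc : ∀ x y, ENNReal.ofReal (Real.exp (q * (q - 1) * c * ‖x - y‖ ^ 2))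
      ≤ ∫⁻ z, p x z ^ q * p y z ^ (1 - q))
    (u u' : EuclideanSpace ℝ (Fin d)) (η : ℝ) :
    ENNReal.ofReal (Real.exp (q * (q - 1) * ((1 - η) ^ 2 * c + η ^ 2 * b) * ‖u - u'‖ ^ 2)) ≤
      ∫⁻ z, (∫⁻ w, gaussianDensity d b (w - u) * p w z) ^ q *
        (∫⁻ w, gaussianDensity d b (w - u') * p w z) ^ (1 - q) := by
  set v := η • (u - u')
  have hpz : ∀ z, Measurable fun w => p w z := fun z => hp.of_uncurry_right
  calc _ ≤ ∫⁻ z, ∫⁻ w, (gaussianDensity d b w * p (w + u) z) ^ q *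
        (gaussianDensity d b (w + v) * p (w + (u' + v)) z) ^ (1 - q) := by
        rw [lintegral_lintegral_gaussianDensity_rpow hb hp hpt]
        grw [← lintegral_mono fun w => mul_le_mul_right (hpc (w + u) (w + (u' + v))) _]
        simp only [add_sub_add_left_eq_sub]
        rw [lintegral_gaussianDensity_add_mul_const hb]
        have := exp_mul_exp_shift (b := b) (q := q) (c := c) (η := η) u u' 0
        simp only [add_sub_add_left_eq_sub] at this
        exact this.ge
    _ ≤ _ := by
        refine lintegral_mono fun z => ?_
        dsimp only
        rw [lintegral_gaussianDensity_mul_eq u 0, lintegral_gaussianDensity_mul_eq u' v]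
        simp only [add_zero]
        -- For `q < 1` this is Hölder with exponents `q` and `1-q`, which needs no positivity or
        -- finiteness of the mixtures.
        exact ENNReal.lintegral_mul_norm_pow_le
          (Measurable.mul (by fun_prop) ((hpz z).comp (measurable_add_const _))).aemeasurable
          (Measurable.mul (by fun_prop) ((hpz z).comp (measurable_add_const _))).aemeasurable
          hq0.le (by linarith) (by ring)

theorem regularityConst_one {L h : ℝ} (hL : 0 ≤ L) (hh : 0 < h) :
    regularityConst L h 1 = L ^ 2 * (1 / (4 * h)) := by
  unfold regularityConst
  split_ifs with h0 h1
  · simp [h0]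
  · simp [h1]
  · have h2 : 1 - L ^ 2 ≠ 0 := by
      rw [sub_ne_zero]; exact fun e => h1 ((pow_eq_one_iff_of_nonneg hL two_ne_zero).1 e.symm)
    have e : L ^ (-(2 * ((1 : ℕ) : ℤ))) - 1 = (1 - L ^ 2) / L ^ 2 := by
      rw [zpow_neg]; norm_cast; field_simp
    rw [e]
    field_simp

/-- For `L > 0` this reads `1/C_{N+1} = L⁻²(1/C_N + 4h)`, so `1/C_N = 4h ∑_{k=1}^N L^(-2k)`; the
closed form is the geometric sum. -/
theorem regularityConst_succ {L h : ℝ} (hL : 0 ≤ L) (hh : 0 < h) {N : ℕ} (hN : 1 ≤ N) :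
    regularityConst L h (N + 1) = L ^ 2 * (regularityConst L h N * (1 / (4 * h)) /
      (regularityConst L h N + 1 / (4 * h))) := by
  unfold regularityConst
  split_ifs with h0 h1
  · simp [h0]
  · subst h1
    push_cast
    have : (0 : ℝ) < N := by exact_mod_cast hN
    field_simp
    ring
  · have hne : ∀ k : ℕ, k ≠ 0 → 1 - L ^ k ≠ 0 := fun k hk => by
      rw [sub_ne_zero]; exact fun e => h1 ((pow_eq_one_iff_of_nonneg hL hk).1 e.symm)
    have hz : ∀ k : ℕ, L ^ (-(2 * (k : ℤ))) - 1 = (1 - L ^ (2 * k)) / L ^ (2 * k) := by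
      intro k
      rw [zpow_neg]; norm_cast; field_simp
    have h2 := hne 2 two_ne_zero
    have h3 := hne (2 * N) (by omega)
    have h4 := hne (2 * (N + 1)) (by omega)
    rw [hz, hz]
    have e : (1 - L ^ 2) / (4 * h * ((1 - L ^ (2 * N)) / L ^ (2 * N))) + 1 / (4 * h)
        = (1 - L ^ (2 * (N + 1))) / (4 * h * (1 - L ^ (2 * N))) := by
      field_simp
      ring
    rw [e]
    field_simp
    ring

theorem regularityConst_nonneg {L h : ℝ} (hL : 0 ≤ L) (hh : 0 < h) {N : ℕ} (hN : 1 ≤ N) :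
    0 ≤ regularityConst L h N := by
  induction N, hN using Nat.le_induction with
  | base => rw [regularityConst_one hL hh]; positivity
  | succ n hn ih => rw [regularityConst_succ hL hh hn]; positivity

end ShiftedComposition

/-! ### Transition densities and their Hellinger integrals. -/

section Density

variable {d : ℕ} {b : ℝ}

theorem bind_eq_withDensity {Ω Ω' : Type*} [MeasurableSpace Ω] [MeasurableSpace Ω']
    {m : Measure Ω'} [SFinite m] {κ : Kernel Ω Ω'} {p : Ω → Ω' → ℝ≥0∞}
    (hp : Measurable (Function.uncurry p)) (hκ : ∀ x, κ x = m.withDensity (p x))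
    (μ : Measure Ω) [SFinite μ] :
    μ.bind κ = m.withDensity (fun z => ∫⁻ x, p x z ∂μ) := by
  ext s hs
  rw [Measure.bind_apply hs κ.aemeasurable, withDensity_apply _ hs]
  simp_rw [hκ, withDensity_apply _ hs]
  exact lintegral_lintegral_swap hp.aemeasurable

/-- The density of `n + 1` steps of the chain `x ↦ φ x + noise` with Gaussian noise. -/
def transitionDensity (b : ℝ) (φ : EuclideanSpace ℝ (Fin d) → EuclideanSpace ℝ (Fin d)) :
    ℕ → EuclideanSpace ℝ (Fin d) → EuclideanSpace ℝ (Fin d) → ℝ≥0∞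
  | 0, x, z => gaussianDensity d b (z - φ x)
  | n + 1, x, z => ∫⁻ w, gaussianDensity d b (w - φ x) * transitionDensity b φ n w z

variable {φ : EuclideanSpace ℝ (Fin d) → EuclideanSpace ℝ (Fin d)}

theorem measurable_transitionDensity (hφ : Measurable φ) (n : ℕ) :
    Measurable (Function.uncurry (transitionDensity b φ n)) := by
  induction n with
  | zero =>
    exact measurable_gaussianDensity.comp (measurable_snd.sub (hφ.comp measurable_fst))
  | succ n ih =>
    refine Measurable.lintegral_prod_right' (f := fun r : (EuclideanSpace ℝ (Fin d) ×
      EuclideanSpace ℝ (Fin d)) × EuclideanSpace ℝ (Fin d) =>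
        gaussianDensity d b (r.2 - φ r.1.1) * transitionDensity b φ n r.2 r.1.2) ?_
    refine Measurable.mul (by fun_prop) (ih.comp (f := fun r : (EuclideanSpace ℝ (Fin d) ×
      EuclideanSpace ℝ (Fin d)) × EuclideanSpace ℝ (Fin d) => (r.2, r.1.2)) (by fun_prop))

theorem transitionDensity_ne_zero (hb : 0 < b) (hφ : Measurable φ) (n : ℕ)
    (x z : EuclideanSpace ℝ (Fin d)) : transitionDensity b φ n x z ≠ 0 := by
  induction n generalizing x z with
  | zero => exact gaussianDensity_ne_zero hb _
  | succ n ih =>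
    have hm : Measurable fun w => transitionDensity b φ n w z :=
      (measurable_transitionDensity hφ n).of_uncurry_right
    rw [transitionDensity, ← pos_iff_ne_zero, lintegral_pos_iff_support (by fun_prop),
      Function.support_eq_univ fun w => mul_ne_zero (gaussianDensity_ne_zero hb _) (ih w z)]
    exact Measure.measure_univ_pos.2 (NeZero.ne _)

/-- A crude uniform bound, preserved by averaging; it serves only to give finiteness. -/
theorem transitionDensity_le (hb : 0 < b) (n : ℕ)
    (x z : EuclideanSpace ℝ (Fin d)) : transitionDensity b φ n x z ≤ gaussianDensity d b 0 := by
  induction n generalizing x z with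
  | zero => exact gaussianDensity_le hb _
  | succ n ih =>
    rw [transitionDensity]
    grw [lintegral_mono fun w => mul_le_mul_right (ih w z) _]
    rw [lintegral_mul_const _ (by fun_prop), lintegral_gaussianDensity_sub hb, one_mul]

theorem transitionDensity_ne_top (hb : 0 < b) (n : ℕ)
    (x z : EuclideanSpace ℝ (Fin d)) : transitionDensity b φ n x z ≠ ∞ :=
  ((transitionDensity_le hb n x z).trans_lt (gaussianDensity_ne_top 0).lt_top).ne

theorem langevinKernel_pow_eq_withDensity {V : EuclideanSpace ℝ (Fin d) → ℝ} {h : ℝ} (hh : 0 < h)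
    (n : ℕ) (x : EuclideanSpace ℝ (Fin d)) :
    (langevinKernel V h ^ (n + 1)) x = volume.withDensity
      (transitionDensity (1 / (4 * h)) (fun x => x - h • gradient V x) n x) := by
  have hφ : Measurable (fun x => x - h • gradient V x) :=
    measurable_id.sub ((measurable_gradient V).const_smul h)
  have h1 : ∀ x, langevinKernel V h x = volume.withDensity
      (transitionDensity (1 / (4 * h)) (fun x => x - h • gradient V x) 0 x) := by
    intro x
    rw [langevinKernel, Kernel.comap_apply, heatKernel_eq_withDensity (by positivity)]
    rw [show 1 / (2 * (2 * h)) = 1 / (4 * h) by ring]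
    rfl
  induction n generalizing x with
  | zero => simpa using h1 x
  | succ n ih =>
    rw [pow_succ]
    -- The first step is split off, matching the recursion of `transitionDensity`.
    change ((langevinKernel V h ^ (n + 1)) ∘ₖ langevinKernel V h) x = _
    rw [Kernel.comp_apply, h1 x, bind_eq_withDensity (measurable_transitionDensity hφ n) ih]
    congr 1
    ext z
    rw [lintegral_withDensity_eq_lintegral_mul]
    · rfl
    · exact (measurable_transitionDensity hφ 0).of_uncurry_left
    · exact (measurable_transitionDensity hφ n).of_uncurry_right

variable {L h : ℝ}

/-- The value of `(1-η)²k + η²b` at its minimizer `η = k/(k+b)`. -/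
theorem shift_identity {k b : ℝ} (hk : 0 ≤ k) (hb : 0 < b) :
    (1 - k / (k + b)) ^ 2 * k + (k / (k + b)) ^ 2 * b = k * b / (k + b) := by
  have : k + b ≠ 0 := by positivity
  field_simp
  ring

theorem lintegral_gaussianDensity_rpow_mul_rpow (hb : 0 < b) (q : ℝ)
    (u u' : EuclideanSpace ℝ (Fin d)) :
    ∫⁻ z, gaussianDensity d b (z - u) ^ q * gaussianDensity d b (z - u') ^ (1 - q) =
      ENNReal.ofReal (Real.exp (q * (q - 1) * b * ‖u - u'‖ ^ 2)) := by
  have e : ∀ z, gaussianDensity d b (z - u) ^ q * gaussianDensity d b (z - u') ^ (1 - q) =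
      gaussianDensity d b (z + (-u + (1 - q) • (u - u'))) *
        ENNReal.ofReal (Real.exp (q * (q - 1) * b * ‖u - u'‖ ^ 2)) := by
    intro z
    rw [← sub_add_sub_cancel z u u', gaussianDensity_rpow_mul_rpow hb]
    congr 2
    module
  simp_rw [e]
  exact lintegral_gaussianDensity_add_mul_const hb _ _

theorem mul_sq_norm_sub_le (hLip : ∀ x y, ‖φ x - φ y‖ ≤ L * ‖x - y‖) {k : ℝ} (hk : 0 ≤ k)
    (x y : EuclideanSpace ℝ (Fin d)) :
    k * ‖φ x - φ y‖ ^ 2 ≤ L ^ 2 * k * ‖x - y‖ ^ 2 := by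
  rw [mul_comm (L ^ 2), mul_assoc, ← mul_pow]
  exact mul_le_mul_of_nonneg_left (pow_le_pow_left₀ (norm_nonneg _) (hLip x y) 2) hk

theorem lintegral_transitionDensity_rpow_le (hh : 0 < h) (hL : 0 ≤ L) (hφ : Measurable φ)
    (hLip : ∀ x y, ‖φ x - φ y‖ ≤ L * ‖x - y‖) {q : ℝ} (hq : 1 < q) (n : ℕ)
    (x y : EuclideanSpace ℝ (Fin d)) :
    ∫⁻ z, transitionDensity (1 / (4 * h)) φ n x z ^ q *
        transitionDensity (1 / (4 * h)) φ n y z ^ (1 - q)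
      ≤ ENNReal.ofReal (Real.exp (q * (q - 1) * regularityConst L h (n + 1) * ‖x - y‖ ^ 2)) := by
  have hb : 0 < 1 / (4 * h) := by positivity
  have hq1 : 0 ≤ q * (q - 1) := mul_nonneg (by linarith) (by linarith)
  induction n generalizing x y with
  | zero =>
    refine (lintegral_gaussianDensity_rpow_mul_rpow hb q (φ x) (φ y)).trans_le ?_
    rw [regularityConst_one hL hh, mul_assoc, mul_assoc (q * (q - 1))]
    exact ENNReal.ofReal_le_ofReal (Real.exp_le_exp.2
      (mul_le_mul_of_nonneg_left (mul_sq_norm_sub_le hLip hb.le x y) hq1))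
  | succ n ih =>
    have hk := regularityConst_nonneg hL hh (N := n + 1) (by omega)
    rw [regularityConst_succ hL hh (N := n + 1) (by omega)]
    set k := regularityConst L h (n + 1)
    refine (lintegral_rpow_gaussian_mixture_le hb (measurable_transitionDensity hφ n)
      (transitionDensity_ne_zero hb hφ n) (transitionDensity_ne_top hb n) hq ih (φ x) (φ y)
      (k / (k + 1 / (4 * h))) (transitionDensity_ne_zero hb hφ (n + 1) y)
      (transitionDensity_ne_top hb (n + 1) y)).trans ?_
    rw [shift_identity hk hb, mul_assoc, mul_assoc (q * (q - 1))]
    exact ENNReal.ofReal_le_ofReal (Real.exp_le_exp.2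
      (mul_le_mul_of_nonneg_left (mul_sq_norm_sub_le hLip (by positivity) x y) hq1))

theorem le_lintegral_transitionDensity_rpow (hh : 0 < h) (hL : 0 ≤ L) (hφ : Measurable φ)
    (hLip : ∀ x y, ‖φ x - φ y‖ ≤ L * ‖x - y‖) {q : ℝ} (hq0 : 0 < q) (hq : q < 1) (n : ℕ)
    (x y : EuclideanSpace ℝ (Fin d)) :
    ENNReal.ofReal (Real.exp (q * (q - 1) * regularityConst L h (n + 1) * ‖x - y‖ ^ 2))
      ≤ ∫⁻ z, transitionDensity (1 / (4 * h)) φ n x z ^ q *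
        transitionDensity (1 / (4 * h)) φ n y z ^ (1 - q) := by
  have hb : 0 < 1 / (4 * h) := by positivity
  have hq1 : q * (q - 1) ≤ 0 := mul_nonpos_of_nonneg_of_nonpos hq0.le (by linarith)
  induction n generalizing x y with
  | zero =>
    refine le_trans ?_ (lintegral_gaussianDensity_rpow_mul_rpow hb q (φ x) (φ y)).ge
    rw [regularityConst_one hL hh, mul_assoc, mul_assoc (q * (q - 1)) (1 / (4 * h))]
    exact ENNReal.ofReal_le_ofReal (Real.exp_le_exp.2
      (mul_le_mul_of_nonpos_left (mul_sq_norm_sub_le hLip hb.le x y) hq1))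
  | succ n ih =>
    have hk := regularityConst_nonneg hL hh (N := n + 1) (by omega)
    rw [regularityConst_succ hL hh (N := n + 1) (by omega)]
    set k := regularityConst L h (n + 1)
    refine le_trans ?_ (le_lintegral_rpow_gaussian_mixture hb (measurable_transitionDensity hφ n)
      (transitionDensity_ne_top hb n) hq0 hq ih (φ x) (φ y) (k / (k + 1 / (4 * h))))
    rw [shift_identity hk hb, mul_assoc, mul_assoc (q * (q - 1)) (k * (1 / (4 * h)) / _)]
    exact ENNReal.ofReal_le_ofReal (Real.exp_le_exp.2
      (mul_le_mul_of_nonpos_left (mul_sq_norm_sub_le hLip (by positivity) x y) hq1))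

/-! ### Rényi and Kullback-Leibler divergences through Hellinger integrals. -/

section Divergence

variable {Ω : Type*} [MeasurableSpace Ω] {m : Measure Ω} {f g : Ω → ℝ≥0∞}

theorem withDensity_eq_withDensity_withDensity_div (hf : Measurable f) (hg : Measurable g)
    (hg0 : ∀ x, g x ≠ 0) (hgt : ∀ x, g x ≠ ∞) :
    m.withDensity f = (m.withDensity g).withDensity (fun x => f x / g x) := by
  refine Eq.trans ?_ (withDensity_mul _ hg (hf.div hg))
  congr 1
  ext x
  exact (ENNReal.mul_div_cancel (hg0 x) (hgt x)).symm

theorem rnDeriv_withDensity_withDensity [SigmaFinite m] (hf : Measurable f) (hg : Measurable g)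
    (hg0 : ∀ x, g x ≠ 0) (hgt : ∀ x, g x ≠ ∞) :
    (m.withDensity f).rnDeriv (m.withDensity g) =ᵐ[m.withDensity g] fun x => f x / g x := by
  have : SigmaFinite (m.withDensity g) := SigmaFinite.withDensity_of_ne_top (ae_of_all _ hgt)
  rw [withDensity_eq_withDensity_withDensity_div hf hg hg0 hgt]
  exact Measure.rnDeriv_withDensity _ (hf.div hg)

theorem withDensity_absolutelyContinuous_withDensity (hf : Measurable f) (hg : Measurable g)
    (hg0 : ∀ x, g x ≠ 0) (hgt : ∀ x, g x ≠ ∞) : m.withDensity f ≪ m.withDensity g := by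
  rw [withDensity_eq_withDensity_withDensity_div hf hg hg0 hgt]
  exact withDensity_absolutelyContinuous _ _

theorem lintegral_div_rpow_withDensity (hf : Measurable f) (hg : Measurable g)
    (hg0 : ∀ x, g x ≠ 0) (hgt : ∀ x, g x ≠ ∞) {q : ℝ} (hq : 0 ≤ q) :
    ∫⁻ x, (f x / g x) ^ q ∂(m.withDensity g) = ∫⁻ x, f x ^ q * g x ^ (1 - q) ∂m := by
  rw [lintegral_withDensity_eq_lintegral_mul _ hg (by fun_prop)]
  refine lintegral_congr fun x => ?_
  rw [Pi.mul_apply, ENNReal.div_rpow_of_nonneg _ _ hq, ENNReal.rpow_sub _ _ (hg0 x) (hgt x),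
    ENNReal.rpow_one]
  simp only [div_eq_mul_inv]
  ring

/-- Positivity and finiteness of `g` force absolute continuity, so only that branch of `renyiDiv`
matters, also for `q < 1`. -/
theorem renyiDiv_withDensity [SigmaFinite m] (hf : Measurable f) (hg : Measurable g)
    (hg0 : ∀ x, g x ≠ 0) (hgt : ∀ x, g x ≠ ∞) {q : ℝ} (hq : 0 ≤ q) (hq1 : q ≠ 1) :
    renyiDiv q (m.withDensity f) (m.withDensity g) =
      (((q - 1)⁻¹ : ℝ) : EReal) * ENNReal.log (∫⁻ x, f x ^ q * g x ^ (1 - q) ∂m) := by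
  rw [renyiDiv, if_neg hq1, if_pos (withDensity_absolutelyContinuous_withDensity hf hg hg0 hgt),
    ← lintegral_div_rpow_withDensity hf hg hg0 hgt hq]
  congr 2
  refine lintegral_congr_ae ?_
  filter_upwards [rnDeriv_withDensity_withDensity hf hg hg0 hgt] with x hx
  rw [hx]

/-- Weighted AM-GM, `t^q ≤ qt + (1-q)`. It ensures that `ENNReal.ofReal` does not truncate the
approximations of `klFun`. -/
theorem klFun_approx_nonneg {t q : ℝ} (ht : 0 ≤ t) (hq0 : 0 ≤ q) (hq : q < 1) :
    0 ≤ (t - t ^ q) / (1 - q) - t + 1 := by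
  have h1 : 0 < 1 - q := by linarith
  have := Real.geom_mean_le_arith_mean2_weighted hq0 h1.le ht zero_le_one (by ring)
  simp only [Real.one_rpow, mul_one] at this
  have : t - 1 ≤ (t - t ^ q) / (1 - q) := by
    rw [le_div_iff₀ h1]; linarith
  linarith

/-- The quotient is the slope of `q ↦ t^q` between `q` and `1`, and it tends to `t log t`. The `+ 2`
keeps every `q` inside `(0,1)`. -/
theorem tendsto_klFun_approx {t : ℝ} (ht : 0 < t) :
    Filter.Tendsto (fun n : ℕ =>
        (t - t ^ (1 - 1 / ((n : ℝ) + 2))) / (1 - (1 - 1 / ((n : ℝ) + 2))) - t + 1)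
      Filter.atTop (nhds (klFun t)) := by
  have hd : HasDerivAt (fun q : ℝ => t ^ q) (t * Real.log t) 1 := by
    simpa using Real.hasStrictDerivAt_const_rpow ht 1 |>.hasDerivAt
  have hs := hasDerivAt_iff_tendsto_slope.1 hd
  have hq : Filter.Tendsto (fun n : ℕ => 1 - 1 / ((n : ℝ) + 2)) Filter.atTop
      (nhdsWithin 1 {1}ᶜ) := by
    refine tendsto_nhdsWithin_iff.2 ⟨?_, Filter.Eventually.of_forall fun n => ?_⟩
    · have : Filter.Tendsto (fun n : ℕ => 1 / ((n : ℝ) + 2)) Filter.atTop (nhds 0) :=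
        tendsto_const_nhds.div_atTop
          (Filter.tendsto_atTop_add_const_right _ _ tendsto_natCast_atTop_atTop)
      simpa using this.const_sub 1
    · have : (0 : ℝ) < 1 / ((n : ℝ) + 2) := by positivity
      simp only [Set.mem_compl_iff, Set.mem_singleton_iff]
      linarith
  have := ((hs.comp hq).sub_const t).add_const 1
  rw [show klFun t = t * Real.log t - t + 1 by rw [klFun]; ring]
  refine this.congr fun n => ?_
  simp only [Function.comp_apply, slope_def_field, Real.rpow_one]
  congr 2
  rw [← neg_div_neg_eq]
  congr 1 <;> ring

/-- The Kullback-Leibler divergence is controlled by the Hellinger integrals of order `q ↑ 1`. -/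
theorem klDiv_withDensity_le [SigmaFinite m] (hf : Measurable f) (hg : Measurable g)
    (hf0 : ∀ x, f x ≠ 0) (hft : ∀ x, f x ≠ ∞)
    (hg0 : ∀ x, g x ≠ 0) (hgt : ∀ x, g x ≠ ∞) (hf1 : ∫⁻ x, f x ∂m = 1) (hg1 : ∫⁻ x, g x ∂m = 1)
    {K : ℝ≥0∞}
    (hK : ∀ q : ℝ, 0 < q → q < 1 →
      1 ≤ (∫⁻ x, f x ^ q * g x ^ (1 - q) ∂m) + ENNReal.ofReal (1 - q) * K) :
    klDiv (m.withDensity f) (m.withDensity g) ≤ K := by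
  have i1 : IsProbabilityMeasure (m.withDensity f) := ⟨by simp [hf1]⟩
  have i2 : IsProbabilityMeasure (m.withDensity g) := ⟨by simp [hg1]⟩
  rw [klDiv_eq_lintegral_klFun_of_ac (withDensity_absolutelyContinuous_withDensity hf hg hg0 hgt)]
  set ν := m.withDensity g with hν
  let t : Ω → ℝ := fun x => (f x / g x).toReal
  have ht : Measurable t := (hf.div hg).ennreal_toReal
  have ht0 : ∀ x, 0 < t x := fun x =>
    ENNReal.toReal_pos (ENNReal.div_ne_zero.2 ⟨hf0 x, hgt x⟩) (ENNReal.div_ne_top (hft x) (hg0 x))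
  have hofReal : ∀ x, ENNReal.ofReal (t x) = f x / g x := fun x =>
    ENNReal.ofReal_toReal (ENNReal.div_ne_top (hft x) (hg0 x))
  have ht1 : ∫⁻ x, ENNReal.ofReal (t x) ∂ν = 1 := by
    simp_rw [hofReal]
    rw [hν, ← setLIntegral_univ, ← withDensity_apply _ MeasurableSet.univ,
      ← withDensity_eq_withDensity_withDensity_div hf hg hg0 hgt, measure_univ]
  let F : ℝ → Ω → ℝ := fun q x => (t x - t x ^ q) / (1 - q) - t x + 1
  have hF : ∀ q, 0 < q → q < 1 → ∫⁻ x, ENNReal.ofReal (F q x) ∂ν ≤ K := by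
    intro q hq0 hq
    have h1q : 0 < 1 - q := by linarith
    set H := ∫⁻ x, f x ^ q * g x ^ (1 - q) ∂m with hH
    have hH' : H = ∫⁻ x, ENNReal.ofReal (t x ^ q) ∂ν := by
      rw [hH, hν, ← lintegral_div_rpow_withDensity hf hg hg0 hgt hq0.le]
      refine lintegral_congr fun x => ?_
      rw [← hofReal, ENNReal.ofReal_rpow_of_nonneg (ht0 x).le hq0.le]
    -- Pointwise `(1-q)F + t^q = qt + (1-q)`, and the right side integrates to `1`. Comparing with
    -- `hK` and cancelling the finite `H` bounds the integral of `F` by `K`.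
    have hF1 : ENNReal.ofReal (1 - q) * (∫⁻ x, ENNReal.ofReal (F q x) ∂ν) + H = 1 := by
      rw [hH', ← lintegral_const_mul _ (by fun_prop), ← lintegral_add_right _ (by fun_prop)]
      have e : ∀ x, ENNReal.ofReal (1 - q) * ENNReal.ofReal (F q x) + ENNReal.ofReal (t x ^ q)
          = ENNReal.ofReal q * ENNReal.ofReal (t x) + ENNReal.ofReal (1 - q) := by
        intro x
        have := klFun_approx_nonneg (ht0 x).le hq0.le hq
        have := (ht0 x).le
        rw [← ENNReal.ofReal_mul h1q.le, ← ENNReal.ofReal_mul hq0.le,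
          ← ENNReal.ofReal_add (by positivity) (by positivity),
          ← ENNReal.ofReal_add (by positivity) (by positivity)]
        congr 1
        simp only [F]
        field_simp
        ring
      simp_rw [e]
      rw [lintegral_add_right _ (by fun_prop), lintegral_const_mul _ (by fun_prop), ht1,
        lintegral_const, measure_univ, mul_one, mul_one, ← ENNReal.ofReal_add hq0.le h1q.le]
      simp
    have hHt : H ≠ ∞ := by
      intro e; rw [e] at hF1; simp at hF1
    have key := hK q hq0 hq
    rw [← hF1, add_comm] at key
    have := (ENNReal.add_le_add_iff_left hHt).1 key
    exact (ENNReal.mul_le_mul_iff_right (by simpa using hq) ENNReal.ofReal_ne_top).1 this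
  have e : ∫⁻ x, ENNReal.ofReal (klFun ((m.withDensity f).rnDeriv ν x).toReal) ∂ν
      = ∫⁻ x, Filter.liminf (fun n : ℕ => ENNReal.ofReal (F (1 - 1 / ((n : ℝ) + 2)) x))
        Filter.atTop ∂ν := by
    refine lintegral_congr_ae ?_
    filter_upwards [rnDeriv_withDensity_withDensity hf hg hg0 hgt] with x hx
    rw [hx]
    exact ((ENNReal.continuous_ofReal.tendsto _).comp
      (tendsto_klFun_approx (ht0 x))).liminf_eq.symm
  rw [e]
  -- Fatou's lemma carries the bound `K`, uniform in `q`, to the limit.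
  refine (lintegral_liminf_le fun n => by fun_prop).trans ?_
  refine Filter.liminf_le_of_frequently_le' (Filter.Frequently.of_forall fun n => hF _ ?_ ?_)
  · have : 1 / ((n : ℝ) + 2) < 1 := by
      rw [div_lt_one (by positivity)]; linarith [(Nat.cast_nonneg n : (0 : ℝ) ≤ n)]
    linarith
  · have : (0 : ℝ) < 1 / ((n : ℝ) + 2) := by positivity
    linarith

end Divergence

end Density

/-! ### From point masses to general initial laws through couplings. -/

section Mixture

variable {d : ℕ} {b L h : ℝ} {φ : EuclideanSpace ℝ (Fin d) → EuclideanSpace ℝ (Fin d)}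

theorem lintegral_transitionDensity (hb : 0 < b) (hφ : Measurable φ) (n : ℕ)
    (x : EuclideanSpace ℝ (Fin d)) : ∫⁻ z, transitionDensity b φ n x z = 1 := by
  induction n generalizing x with
  | zero => exact lintegral_gaussianDensity_sub hb _
  | succ n ih =>
    have hm := measurable_transitionDensity (b := b) hφ n
    simp only [transitionDensity]
    rw [lintegral_lintegral_swap]
    · have e : ∀ w, ∫⁻ z, gaussianDensity d b (w - φ x) * transitionDensity b φ n w z
          = gaussianDensity d b (w - φ x) := fun w => by
        rw [lintegral_const_mul _ hm.of_uncurry_left, ih, mul_one]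
      simp_rw [e]
      exact lintegral_gaussianDensity_sub hb _
    · exact (Measurable.mul (by fun_prop) (hm.comp measurable_swap)).aemeasurable

section Coupling

variable {μ ν : Measure (EuclideanSpace ℝ (Fin d))}
  {γ : Measure (EuclideanSpace ℝ (Fin d) × EuclideanSpace ℝ (Fin d))}

theorem isProbabilityMeasure_of_mem_couplings [IsProbabilityMeasure μ] (hγ : γ ∈ couplings μ ν) :
    IsProbabilityMeasure γ := by
  refine ⟨?_⟩
  have : γ.map Prod.fst Set.univ = 1 := by rw [hγ.1]; exact measure_univ
  rwa [Measure.map_apply measurable_fst MeasurableSet.univ, Set.preimage_univ] at this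

theorem prod_mem_couplings [IsProbabilityMeasure μ] [IsProbabilityMeasure ν] :
    μ.prod ν ∈ couplings μ ν := by
  simp [couplings, Measure.map_fst_prod, Measure.map_snd_prod]

/-- The density of the law after `n + 1` steps, started from `μ`. -/
def lawDensity (b : ℝ) (φ : EuclideanSpace ℝ (Fin d) → EuclideanSpace ℝ (Fin d)) (n : ℕ)
    (μ : Measure (EuclideanSpace ℝ (Fin d))) (z : EuclideanSpace ℝ (Fin d)) : ℝ≥0∞ :=
  ∫⁻ x, transitionDensity b φ n x z ∂μ

theorem measurable_lawDensity [SFinite μ] (hφ : Measurable φ) (n : ℕ) :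
    Measurable (lawDensity b φ n μ) :=
  (measurable_transitionDensity hφ n).lintegral_prod_left'

theorem lawDensity_ne_zero [IsProbabilityMeasure μ] (hb : 0 < b) (hφ : Measurable φ) (n : ℕ)
    (z : EuclideanSpace ℝ (Fin d)) : lawDensity b φ n μ z ≠ 0 := by
  have hm : Measurable fun w => transitionDensity b φ n w z :=
    (measurable_transitionDensity hφ n).of_uncurry_right
  rw [lawDensity, ← pos_iff_ne_zero, lintegral_pos_iff_support hm,
    Function.support_eq_univ fun w => transitionDensity_ne_zero hb hφ n w z]
  simp

theorem lawDensity_ne_top [IsProbabilityMeasure μ] (hb : 0 < b) (n : ℕ)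
    (z : EuclideanSpace ℝ (Fin d)) : lawDensity b φ n μ z ≠ ∞ := by
  refine ne_top_of_le_ne_top (gaussianDensity_ne_top (d := d) (b := b) 0)
    ((lintegral_mono fun w => transitionDensity_le hb n w z).trans ?_)
  simp

theorem lintegral_lawDensity [IsProbabilityMeasure μ] (hb : 0 < b) (hφ : Measurable φ) (n : ℕ) :
    ∫⁻ z, lawDensity b φ n μ z = 1 := by
  unfold lawDensity
  rw [← lintegral_lintegral_swap (measurable_transitionDensity hφ n).aemeasurable]
  simp [lintegral_transitionDensity hb hφ]

theorem lawDensity_eq_lintegral_fst (hφ : Measurable φ) (n : ℕ) (hγ : γ ∈ couplings μ ν)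
    (z : EuclideanSpace ℝ (Fin d)) :
    lawDensity b φ n μ z = ∫⁻ r, transitionDensity b φ n r.1 z ∂γ := by
  rw [lawDensity, ← hγ.1,
    lintegral_map (measurable_transitionDensity hφ n).of_uncurry_right measurable_fst]

theorem lawDensity_eq_lintegral_snd (hφ : Measurable φ) (n : ℕ) (hγ : γ ∈ couplings μ ν)
    (z : EuclideanSpace ℝ (Fin d)) :
    lawDensity b φ n ν z = ∫⁻ r, transitionDensity b φ n r.2 z ∂γ := by
  rw [lawDensity, ← hγ.2,
    lintegral_map (measurable_transitionDensity hφ n).of_uncurry_right measurable_snd]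

theorem lintegral_coupling_swap [SFinite γ] (hφ : Measurable φ) (n : ℕ) (q : ℝ) :
    ∫⁻ z, ∫⁻ r, transitionDensity b φ n r.1 z ^ q * transitionDensity b φ n r.2 z ^ (1 - q) ∂γ =
      ∫⁻ r, (∫⁻ z, transitionDensity b φ n r.1 z ^ q *
        transitionDensity b φ n r.2 z ^ (1 - q)) ∂γ := by
  have hm := measurable_transitionDensity (b := b) hφ n
  refine lintegral_lintegral_swap (Measurable.aemeasurable (Measurable.mul ?_ ?_))
  · exact (hm.comp (f := fun s : EuclideanSpace ℝ (Fin d) ×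
      (EuclideanSpace ℝ (Fin d) × EuclideanSpace ℝ (Fin d)) => (s.2.1, s.1))
      (by fun_prop)).pow_const q
  · exact (hm.comp (f := fun s : EuclideanSpace ℝ (Fin d) ×
      (EuclideanSpace ℝ (Fin d) × EuclideanSpace ℝ (Fin d)) => (s.2.2, s.1))
      (by fun_prop)).pow_const _

/-- Under a coupling both laws are mixtures over the same variable, so joint convexity reduces the
bound to pairs of starting points. -/
theorem lintegral_lawDensity_rpow_le [IsProbabilityMeasure μ] [IsProbabilityMeasure ν]
    (hh : 0 < h) (hL : 0 ≤ L) (hφ : Measurable φ)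
    (hLip : ∀ x y, ‖φ x - φ y‖ ≤ L * ‖x - y‖) {q : ℝ} (hq : 1 < q) (n : ℕ)
    (hγ : γ ∈ couplings μ ν) :
    ∫⁻ z, lawDensity (1 / (4 * h)) φ n μ z ^ q * lawDensity (1 / (4 * h)) φ n ν z ^ (1 - q)
      ≤ ∫⁻ r, ENNReal.ofReal
        (Real.exp (q * (q - 1) * regularityConst L h (n + 1) * ‖r.1 - r.2‖ ^ 2)) ∂γ := by
  have hb : 0 < 1 / (4 * h) := by positivity
  have := isProbabilityMeasure_of_mem_couplings hγ
  have hm := measurable_transitionDensity (b := 1 / (4 * h)) hφ n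
  refine le_trans ?_ ((lintegral_coupling_swap hφ n q).trans_le (lintegral_mono fun r =>
    lintegral_transitionDensity_rpow_le hh hL hφ hLip hq n r.1 r.2))
  refine lintegral_mono fun z => ?_
  have h0 := lawDensity_ne_zero (μ := ν) hb hφ n z
  have ht := lawDensity_ne_top (μ := ν) (φ := φ) hb n z
  dsimp only
  rw [lawDensity_eq_lintegral_snd hφ n hγ] at h0 ht ⊢
  rw [lawDensity_eq_lintegral_fst hφ n hγ]
  exact rpow_lintegral_mul_rpow_lintegral_le (hm.of_uncurry_right.comp measurable_fst)
    (hm.of_uncurry_right.comp measurable_snd) (fun r => transitionDensity_ne_zero hb hφ n _ _)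
    (fun r => transitionDensity_ne_top hb n _ _) h0 ht hq

theorem le_lintegral_lawDensity_rpow [IsProbabilityMeasure μ]
    (hh : 0 < h) (hL : 0 ≤ L) (hφ : Measurable φ)
    (hLip : ∀ x y, ‖φ x - φ y‖ ≤ L * ‖x - y‖) {q : ℝ} (hq0 : 0 < q) (hq : q < 1) (n : ℕ)
    (hγ : γ ∈ couplings μ ν) :
    ∫⁻ r, ENNReal.ofReal
        (Real.exp (q * (q - 1) * regularityConst L h (n + 1) * ‖r.1 - r.2‖ ^ 2)) ∂γ ≤
      ∫⁻ z, lawDensity (1 / (4 * h)) φ n μ z ^ q *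
        lawDensity (1 / (4 * h)) φ n ν z ^ (1 - q) := by
  have := isProbabilityMeasure_of_mem_couplings hγ
  have hm := measurable_transitionDensity (b := 1 / (4 * h)) hφ n
  have hz : ∀ z, Measurable fun w => transitionDensity (1 / (4 * h)) φ n w z :=
    fun z => hm.of_uncurry_right
  calc _ ≤ ∫⁻ r, (∫⁻ z, transitionDensity (1 / (4 * h)) φ n r.1 z ^ q *
        transitionDensity (1 / (4 * h)) φ n r.2 z ^ (1 - q)) ∂γ :=
        lintegral_mono fun r =>
          le_lintegral_transitionDensity_rpow hh hL hφ hLip hq0 hq n r.1 r.2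
    _ = ∫⁻ z, ∫⁻ r, transitionDensity (1 / (4 * h)) φ n r.1 z ^ q *
        transitionDensity (1 / (4 * h)) φ n r.2 z ^ (1 - q) ∂γ :=
        (lintegral_coupling_swap hφ n q).symm
    _ ≤ _ := by
        refine lintegral_mono fun z => ?_
        dsimp only
        rw [lawDensity_eq_lintegral_snd hφ n hγ, lawDensity_eq_lintegral_fst hφ n hγ]
        exact ENNReal.lintegral_mul_norm_pow_le ((hz z).comp measurable_fst).aemeasurable
          ((hz z).comp measurable_snd).aemeasurable hq0.le (by linarith) (by ring)

/-- From `1 + s ≤ exp s`; pointwise the slack left over is `(1-q)² C ‖x-y‖² ≥ 0`. This is the form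
that `klDiv_withDensity_le` consumes. -/
theorem one_le_lintegral_exp_add [IsProbabilityMeasure γ] {q C : ℝ} (hq : q < 1)
    (hC : 0 ≤ C) :
    1 ≤ (∫⁻ r, ENNReal.ofReal (Real.exp (q * (q - 1) * C * ‖r.1 - r.2‖ ^ 2)) ∂γ) +
      ENNReal.ofReal (1 - q) *
        (ENNReal.ofReal C * ∫⁻ r, ENNReal.ofReal (‖r.1 - r.2‖ ^ 2) ∂γ) := by
  rw [← mul_assoc, ← lintegral_const_mul _ (by fun_prop), ← lintegral_add_right _ (by fun_prop)]
  calc (1 : ℝ≥0∞) = ∫⁻ _, 1 ∂γ := by simp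
    _ ≤ _ := by
      refine lintegral_mono fun r => ?_
      have h1q : 0 ≤ 1 - q := by linarith
      dsimp only
      rw [← ENNReal.ofReal_mul h1q, ← ENNReal.ofReal_mul (by positivity),
        ← ENNReal.ofReal_add (by positivity) (by positivity), ← ENNReal.ofReal_one]
      refine ENNReal.ofReal_le_ofReal ?_
      have h1 := Real.add_one_le_exp (q * (q - 1) * C * ‖r.1 - r.2‖ ^ 2)
      have h2 : 0 ≤ (1 - q) * C * ‖r.1 - r.2‖ ^ 2 := by positivity
      nlinarith

end Coupling

theorem langevinLaw_eq_withDensity {V : EuclideanSpace ℝ (Fin d) → ℝ} (hh : 0 < h) (n : ℕ)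
    (μ : Measure (EuclideanSpace ℝ (Fin d))) [IsProbabilityMeasure μ] :
    langevinLaw V h (n + 1) μ = volume.withDensity
      (lawDensity (1 / (4 * h)) (fun x => x - h • gradient V x) n μ) :=
  bind_eq_withDensity (measurable_transitionDensity
    (measurable_id.sub ((measurable_gradient V).const_smul h)) n)
    (langevinKernel_pow_eq_withDensity hh n) μ

theorem wasserstein2_sq (μ ν : Measure (EuclideanSpace ℝ (Fin d))) :
    wasserstein2 μ ν ^ 2 =
      ⨅ γ ∈ couplings μ ν, ∫⁻ p, ENNReal.ofReal (‖p.1 - p.2‖ ^ 2) ∂γ := by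
  rw [wasserstein2, ← ENNReal.rpow_natCast, ← ENNReal.rpow_mul]
  norm_num

theorem inv_mul_log_le_of_one_lt {q : ℝ} (hq : 1 < q) {A B : ℝ≥0∞} (hAB : A ≤ B) :
    (((q - 1)⁻¹ : ℝ) : EReal) * ENNReal.log A ≤ (((q - 1)⁻¹ : ℝ) : EReal) * ENNReal.log B :=
  mul_le_mul_of_nonneg_left (ENNReal.log_monotone hAB)
    (EReal.coe_nonneg.2 (inv_nonneg.2 (by linarith)))

theorem inv_mul_log_le_of_lt_one {q : ℝ} (hq : q < 1) {A B : ℝ≥0∞} (hAB : B ≤ A) :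
    (((q - 1)⁻¹ : ℝ) : EReal) * ENNReal.log A ≤ (((q - 1)⁻¹ : ℝ) : EReal) * ENNReal.log B := by
  rw [show (q - 1)⁻¹ = -(1 - q)⁻¹ by rw [← neg_sub, inv_neg], EReal.coe_neg, EReal.neg_mul,
    EReal.neg_mul, EReal.neg_le_neg_iff]
  exact mul_le_mul_of_nonneg_left (ENNReal.log_monotone hAB)
    (EReal.coe_nonneg.2 (inv_nonneg.2 (by linarith)))

end Mixture

end LangevinRegularity

end

open LangevinRegularity in
theorem theorem3p10 (d : ℕ) (V : EuclideanSpace ℝ (Fin d) → ℝ) (α β h L : ℝ) (N : ℕ)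
    (hV : Differentiable ℝ V) (hV' : Differentiable ℝ (gradient V))
    (hα : ∀ x v, α * ‖v‖ ^ 2 ≤ inner ℝ (LangevinRegularity.hessian V x v) v)
    (hβ : ∀ x v, inner ℝ (LangevinRegularity.hessian V x v) v ≤ β * ‖v‖ ^ 2)
    (hh : 0 < h) (hN : 1 ≤ N) (hL : L = max |1 - h * α| |1 - h * β|)
    (μ ν : Measure (EuclideanSpace ℝ (Fin d))) [IsProbabilityMeasure μ] [IsProbabilityMeasure ν] :
    klDiv (LangevinRegularity.langevinLaw V h N μ)
        (LangevinRegularity.langevinLaw V h N ν)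
      ≤ ENNReal.ofReal (LangevinRegularity.regularityConst L h N)
          * LangevinRegularity.wasserstein2 μ ν ^ 2 ∧
    ∀ q : ℝ, 0 < q → q ≠ 1 →
      LangevinRegularity.renyiDiv q (LangevinRegularity.langevinLaw V h N μ)
          (LangevinRegularity.langevinLaw V h N ν)
        ≤ ⨅ γ ∈ LangevinRegularity.couplings μ ν,
            (((q - 1)⁻¹ : ℝ) : EReal) * ENNReal.log (∫⁻ p, ENNReal.ofReal (Real.exp
              (q * (q - 1) * LangevinRegularity.regularityConst L h N * ‖p.1 - p.2‖ ^ 2)) ∂γ) := by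
  -- Index `n` of the densities stands for `n + 1` steps.
  obtain ⟨n, rfl⟩ := Nat.exists_eq_add_of_le' hN
  have hLip := norm_gradientStep_sub_le hV hV' hα hβ hh
  rw [← hL] at hLip
  have hL0 : 0 ≤ L := hL ▸ le_max_of_le_left (abs_nonneg _)
  have hb : 0 < 1 / (4 * h) := by positivity
  have hφ : Measurable (fun x => x - h • gradient V x) :=
    measurable_id.sub ((measurable_gradient V).const_smul h)
  have hC := regularityConst_nonneg hL0 hh hN
  rw [langevinLaw_eq_withDensity hh, langevinLaw_eq_withDensity hh]
  constructor
  · have key : ∀ γ ∈ couplings μ ν, klDiv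
        (volume.withDensity (lawDensity (1 / (4 * h)) (fun x => x - h • gradient V x) n μ))
        (volume.withDensity (lawDensity (1 / (4 * h)) (fun x => x - h • gradient V x) n ν)) ≤
        ENNReal.ofReal (regularityConst L h (n + 1)) *
          ∫⁻ p, ENNReal.ofReal (‖p.1 - p.2‖ ^ 2) ∂γ := by
      intro γ hγ
      have := isProbabilityMeasure_of_mem_couplings hγ
      refine klDiv_withDensity_le (measurable_lawDensity hφ n) (measurable_lawDensity hφ n)
        (lawDensity_ne_zero hb hφ n) (lawDensity_ne_top hb n) (lawDensity_ne_zero hb hφ n)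
        (lawDensity_ne_top hb n) (lintegral_lawDensity hb hφ n) (lintegral_lawDensity hb hφ n)
        fun q hq0 hq => (one_le_lintegral_exp_add (γ := γ) hq hC).trans ?_
      gcongr
      exact le_lintegral_lawDensity_rpow hh hL0 hφ hLip hq0 hq n hγ
    rw [wasserstein2_sq]
    -- A zero constant cannot be moved inside an infimum that may be infinite; in that case the
    -- product coupling alone already gives divergence `0`.
    rcases hC.eq_or_lt with h0 | h0
    · have := key _ prod_mem_couplings
      simpa [← h0] using this
    · have h1 : ENNReal.ofReal (regularityConst L h (n + 1)) ≠ 0 := by simpa using h0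
      simp_rw [ENNReal.mul_iInf_of_ne h1 ENNReal.ofReal_ne_top]
      exact le_iInf₂ key
  · intro q hq0 hq1
    rw [renyiDiv_withDensity (measurable_lawDensity hφ n) (measurable_lawDensity hφ n)
      (lawDensity_ne_zero hb hφ n) (lawDensity_ne_top hb n) hq0.le hq1]
    refine le_iInf₂ fun γ hγ => ?_
    rcases lt_or_gt_of_ne hq1 with hq | hq
    · exact inv_mul_log_le_of_lt_one hq (le_lintegral_lawDensity_rpow hh hL0 hφ hLip hq0 hq n hγ)
    · exact inv_mul_log_le_of_one_lt hq (lintegral_lawDensity_rpow_le hh hL0 hφ hLip hq n hγ)
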